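/- Let $a,b,c,d,e,f$ be six distinct points in $\mathbb{R}^3$, no four of which are coplanar. Let $T$ be the triangle determined by $\{a,b,c\}$, that is, the closed curve formed by the three edges $[a,b],[b,c],[c,a]$, and let $T'$ be the triangle determined by $\{d,e,f\}$. Call $T$ and $T'$ linked if they are disjoint and their linking number $\mathrm{lk}(T,T')$ is nonzero, where, for either choice of orientations, $$\mathrm{lk}(T,T')=\frac1{4\pi}\oint_{T}\oint_{T'}\frac{\det(dx,\,dy,\,x-y)}{\|x-y\|^3}.$$ Then the following are equivalent: (1) $T$ and $T'$ are linked. (2) Exactly one edge of $T$ intersects the convex hull of $\{d,e,f\}$. (3) Exactly one edge of $T'$ intersects the convex hull of $\{a,b,c\}$. -/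

import Mathlib

noncomputable section

/-- Euclidean 3-space. -/
abbrev E3 : Type := EuclideanSpace ℝ (Fin 3)

/-- The scalar triple product `det (u, v, w)` of three vectors in `ℝ³`. -/
def tripleProduct (u v w : E3) : ℝ :=
  Matrix.det !![u 0, u 1, u 2; v 0, v 1, v 2; w 0, w 1, w 2]

/-- The Gauss double integral
`∫₀¹ ∫₀¹ det (γ'(s), δ'(t), γ(s) - δ(t)) / ‖γ(s) - δ(t)‖³ dt ds`
of two arcs `γ, δ : [0, 1] → ℝ³` (well behaved for disjoint `C¹` arcs). -/
def gaussIntegral (γ δ : ℝ → E3) : ℝ :=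
  ∫ s in (0 : ℝ)..1, ∫ t in (0 : ℝ)..1,
    tripleProduct (deriv γ s) (deriv δ t) (γ s - δ t) / ‖γ s - δ t‖ ^ 3

/-- The `i`-th oriented edge of the triangle with vertices `p 0, p 1, p 2`, as an arc
`t ↦ (1 - t) p_i + t p_{i+1}` (indices modulo `3`). -/
def edgeArc (p : Fin 3 → E3) (i : Fin 3) : ℝ → E3 :=
  fun t => AffineMap.lineMap (p i) (p (i + 1)) t

/-- The set of the three edges of the triangle with vertices `p 0, p 1, p 2`. -/
def triangleEdges (p : Fin 3 → E3) : Set (Set E3) :=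
  Set.range fun i : Fin 3 => segment ℝ (p i) (p (i + 1))

/-- The triangle with vertices `p 0, p 1, p 2`, as a closed curve: the union of its edges. -/
def triangleCurve (p : Fin 3 → E3) : Set E3 :=
  ⋃₀ triangleEdges p

/-- The linking number of two disjoint triangles, each oriented by the cyclic order of its
vertices: Gauss's linking integral `1/(4π) ∮∮ det (dx, dy, x - y) / ‖x - y‖³` of the two closed
polygonal curves, split into the contributions of the pairs of edges. -/
def linkingNumber (p q : Fin 3 → E3) : ℝ :=
  1 / (4 * Real.pi) * ∑ i : Fin 3, ∑ j : Fin 3, gaussIntegral (edgeArc p i) (edgeArc q j)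

/-- Two triangles are linked if they are disjoint as closed curves and their linking number is
nonzero (reordering the vertices changes the linking number at most by a sign). -/
def Linked (p q : Fin 3 → E3) : Prop :=
  Disjoint (triangleCurve p) (triangleCurve q) ∧ linkingNumber p q ≠ 0

end

open scoped RealInnerProductSpace

/-! Let a point `x` run along an edge of the first triangle. The Gauss integral of that edge against
the second triangle is the change of the solid angle under which `x` sees the second triangle. Half
this solid angle is the argument of the explicit complex number `angleNum`, and `angleNum_logDeriv`
identifies the derivative of the argument with half the sum of the Biot-Savart terms of the three
sides, which are the inner Gauss integrals (`gaussIntegral_lineMap`). The principal argument jumps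
only where `angleNum` crosses the negative real axis. Its imaginary part vanishes when `x` is in the
plane of the triangle, and there its real part is negative inside the triangle and positive outside
(`angleRe_neg_of_mem_convexHull`, `angleRe_pos_of_notMem_convexHull`). So an edge contributes a
difference of end values plus a signed jump for a hit (`sum_gaussIntegral_lineMap`). Around the
closed curve the differences telescope, and the linking number is the signed count of hits
(`GeneralPosition.linkingNumber_eq`). A hit edge has its ends on opposite sides of the plane. Hence
three hits are impossible and two hits have opposite signs, so the count is nonzero exactly when
there is one hit. Fubini makes the linking number symmetric, which gives the third condition. -/

/-! ### Triple products and the complex number of the solid angle. -/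

lemma tripleProduct_eq (u v w : E3) : tripleProduct u v w =
    u 0 * (v 1 * w 2 - v 2 * w 1) - u 1 * (v 0 * w 2 - v 2 * w 0)
      + u 2 * (v 0 * w 1 - v 1 * w 0) := by
  simp [tripleProduct, Matrix.det_fin_three]
  ring

lemma inner_eq_coords (u v : E3) : ⟪u, v⟫ = u 0 * v 0 + u 1 * v 1 + u 2 * v 2 := by
  simp [PiLp.inner_apply, Fin.sum_univ_three]
  ring

lemma norm_sq_eq_coords (u : E3) : ‖u‖ ^ 2 = u 0 * u 0 + u 1 * u 1 + u 2 * u 2 := by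
  rw [← real_inner_self_eq_norm_sq, inner_eq_coords]

/-- Cramer's rule, paired with a further vector. -/
lemma tripleProduct_mul_inner (A B C v w : E3) :
    tripleProduct A B C * ⟪w, v⟫ = tripleProduct B C v * ⟪w, A⟫
      + tripleProduct C A v * ⟪w, B⟫ + tripleProduct A B v * ⟪w, C⟫ := by
  simp only [tripleProduct_eq, inner_eq_coords]
  ring

/-- The right-hand side is the Gram determinant of the three vectors. -/
lemma tripleProduct_sq (A B C : E3) : tripleProduct A B C ^ 2 =
    ‖A‖ ^ 2 * ‖B‖ ^ 2 * ‖C‖ ^ 2 + 2 * ⟪A, B⟫ * ⟪B, C⟫ * ⟪C, A⟫ - ‖A‖ ^ 2 * ⟪B, C⟫ ^ 2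
      - ‖B‖ ^ 2 * ⟪C, A⟫ ^ 2 - ‖C‖ ^ 2 * ⟪A, B⟫ ^ 2 := by
  simp only [norm_sq_eq_coords, tripleProduct_eq, inner_eq_coords]
  ring

/-- The real part of the complex number whose argument is half the solid angle of the
triangle with vertices `A, B, C` seen from the origin. -/
noncomputable def angleRe (A B C : E3) : ℝ :=
  ‖A‖ * ‖B‖ * ‖C‖ + ⟪A, B⟫ * ‖C‖ + ⟪B, C⟫ * ‖A‖ + ⟪C, A⟫ * ‖B‖

/-- The complex number of Van Oosterom and Strackee, whose argument is half the solid angle of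
the triangle with vertices `A, B, C` seen from the origin. -/
noncomputable def angleNum (A B C : E3) : ℂ := ⟨angleRe A B C, tripleProduct A B C⟩

/-- The squared modulus of `angleNum` factors over the three sides; the factors are those in the
denominators of `edgeTerm`, which makes the logarithmic derivative split into edge terms. -/
lemma angleRe_sq_add_tripleProduct_sq (A B C : E3) :
    angleRe A B C ^ 2 + tripleProduct A B C ^ 2 =
      2 * (‖A‖ * ‖B‖ + ⟪A, B⟫) * (‖B‖ * ‖C‖ + ⟪B, C⟫) * (‖C‖ * ‖A‖ + ⟪C, A⟫) := by
  rw [tripleProduct_sq, angleRe]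
  ring

lemma norm_pos_of_tripleProduct_ne_zero {A B v : E3} (h : tripleProduct A B v ≠ 0) :
    0 < ‖A‖ ∧ 0 < ‖B‖ := by
  constructor <;> rw [norm_pos_iff] <;> rintro rfl <;> apply h <;> simp [tripleProduct_eq]

/-- By Lagrange's identity the gap is the squared length of the cross product of `A` and `B`, which
is nonzero because it pairs nontrivially with `v`. -/
lemma inner_sq_lt_of_tripleProduct_ne_zero {A B v : E3} (h : tripleProduct A B v ≠ 0) :
    ⟪A, B⟫ ^ 2 < (‖A‖ * ‖B‖) ^ 2 := by
  by_contra! hle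
  have key : (‖A‖ * ‖B‖) ^ 2 - ⟪A, B⟫ ^ 2 = (A 1 * B 2 - A 2 * B 1) ^ 2
      + (A 0 * B 2 - A 2 * B 0) ^ 2 + (A 0 * B 1 - A 1 * B 0) ^ 2 := by
    rw [mul_pow, norm_sq_eq_coords, norm_sq_eq_coords, inner_eq_coords]
    ring
  have h1 : A 1 * B 2 - A 2 * B 1 = 0 := by
    apply pow_eq_zero_iff (two_ne_zero) |>.1
    nlinarith [sq_nonneg (A 1 * B 2 - A 2 * B 1), sq_nonneg (A 0 * B 2 - A 2 * B 0),
      sq_nonneg (A 0 * B 1 - A 1 * B 0)]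
  have h2 : A 0 * B 2 - A 2 * B 0 = 0 := by
    apply pow_eq_zero_iff (two_ne_zero) |>.1
    nlinarith [sq_nonneg (A 1 * B 2 - A 2 * B 1), sq_nonneg (A 0 * B 2 - A 2 * B 0),
      sq_nonneg (A 0 * B 1 - A 1 * B 0)]
  have h3 : A 0 * B 1 - A 1 * B 0 = 0 := by
    apply pow_eq_zero_iff (two_ne_zero) |>.1
    nlinarith [sq_nonneg (A 1 * B 2 - A 2 * B 1), sq_nonneg (A 0 * B 2 - A 2 * B 0),
      sq_nonneg (A 0 * B 1 - A 1 * B 0)]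
  apply h
  rw [tripleProduct_eq]
  linear_combination v 0 * h1 - v 1 * h2 + v 2 * h3

lemma norm_mul_norm_add_inner_pos {A B v : E3} (h : tripleProduct A B v ≠ 0) :
    0 < ‖A‖ * ‖B‖ + ⟪A, B⟫ := by
  have := abs_lt_of_sq_lt_sq (inner_sq_lt_of_tripleProduct_ne_zero h) (by positivity)
  linarith [(abs_lt.1 this).1]

/-! ### Differentiation along the path of the observer. -/

/-- The derivative of the norm of a moving vector. -/
lemma hasDerivAt_norm {A : ℝ → E3} {A' : E3} {s : ℝ} (hA : HasDerivAt A A' s)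
    (h : 0 < ‖A s‖) : HasDerivAt (fun s => ‖A s‖) (⟪A s, A'⟫ / ‖A s‖) s := by
  have h1 := (hA.norm_sq).sqrt (by positivity)
  simp only [norm_nonneg, Real.sqrt_sq] at h1
  convert h1 using 1
  field_simp

lemma hasDerivAt_tripleProduct {A B C : ℝ → E3} {A' B' C' : E3} {s : ℝ}
    (hA : HasDerivAt A A' s) (hB : HasDerivAt B B' s) (hC : HasDerivAt C C' s) :
    HasDerivAt (fun s => tripleProduct (A s) (B s) (C s))
      (tripleProduct A' (B s) (C s) + tripleProduct (A s) B' (C s)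
        + tripleProduct (A s) (B s) C') s := by
  simp only [tripleProduct_eq]
  have coord {F : ℝ → E3} {F' : E3} (hF : HasDerivAt F F' s) (i : Fin 3) :
      HasDerivAt (fun s => F s i) (F' i) s := by
    exact (EuclideanSpace.proj (𝕜 := ℝ) i).hasFDerivAt.comp_hasDerivAt s hF
  refine (((coord hA 0).mul (((coord hB 1).mul (coord hC 2)).sub
    ((coord hB 2).mul (coord hC 1)))).sub ((coord hA 1).mul (((coord hB 0).mul (coord hC 2)).sub
    ((coord hB 2).mul (coord hC 0)))) |>.add ((coord hA 2).mul (((coord hB 0).mul (coord hC 1)).sub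
    ((coord hB 1).mul (coord hC 0))))).congr_deriv ?_
  simp only [Pi.mul_apply, Pi.sub_apply]
  ring

/-- The Biot-Savart integral of the segment from `A` to `B`, in the direction `v`. -/
noncomputable def edgeTerm (A B v : E3) : ℝ :=
  tripleProduct A B v * ((‖A‖ + ‖B‖) / (‖A‖ * ‖B‖ * (‖A‖ * ‖B‖ + ⟪A, B⟫)))

lemma Complex.mk_div_mk_im (x y x' y' : ℝ) :
    ((⟨x', y'⟩ : ℂ) / ⟨x, y⟩).im = (x * y' - y * x') / (x ^ 2 + y ^ 2) := by
  simp only [Complex.div_im, Complex.normSq_mk]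
  ring

lemma hasDerivAt_complex_mk {f g : ℝ → ℝ} {f' g' s : ℝ} (hf : HasDerivAt f f' s)
    (hg : HasDerivAt g g' s) : HasDerivAt (fun s => (⟨f s, g s⟩ : ℂ)) ⟨f', g'⟩ s := by
  simp only [Complex.mk_eq_add_mul_I]
  exact hf.ofReal_comp.add (hg.ofReal_comp.mul_const _)

/-- The logarithmic derivative of `angleNum` for a moving observer. -/
lemma angleNum_logDeriv {A B C : ℝ → E3} {v : E3} {s : ℝ}
    (hA : HasDerivAt A (-v) s) (hB : HasDerivAt B (-v) s) (hC : HasDerivAt C (-v) s)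
    (hAB : tripleProduct (A s) (B s) v ≠ 0) (hBC : tripleProduct (B s) (C s) v ≠ 0)
    (hCA : tripleProduct (C s) (A s) v ≠ 0) :
    ∃ Z' : ℂ, HasDerivAt (fun s => angleNum (A s) (B s) (C s)) Z' s ∧
      (Z' / angleNum (A s) (B s) (C s)).im = (edgeTerm (A s) (B s) v
        + edgeTerm (B s) (C s) v + edgeTerm (C s) (A s) v) / 2 := by
  obtain ⟨ha, hb⟩ := norm_pos_of_tripleProduct_ne_zero hAB
  obtain ⟨-, hc⟩ := norm_pos_of_tripleProduct_ne_zero hBC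
  have dN := ((((hasDerivAt_norm hA ha).mul (hasDerivAt_norm hB hb)).mul
    (hasDerivAt_norm hC hc)).add ((hA.inner ℝ hB).mul (hasDerivAt_norm hC hc))).add
    ((hB.inner ℝ hC).mul (hasDerivAt_norm hA ha)) |>.add
    ((hC.inner ℝ hA).mul (hasDerivAt_norm hB hb))
  have dD := hasDerivAt_tripleProduct hA hB hC
  refine ⟨_, hasDerivAt_complex_mk dN dD, ?_⟩
  have hα := tripleProduct_mul_inner (A s) (B s) (C s) v (A s)
  have hβ := tripleProduct_mul_inner (A s) (B s) (C s) v (B s)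
  have hγ := tripleProduct_mul_inner (A s) (B s) (C s) v (C s)
  have hsq := angleRe_sq_add_tripleProduct_sq (A s) (B s) (C s)
  have hx := norm_mul_norm_add_inner_pos hAB
  have hy := norm_mul_norm_add_inner_pos hBC
  have hz := norm_mul_norm_add_inner_pos hCA
  have e1 : tripleProduct (-v) (B s) (C s) = -tripleProduct (B s) (C s) v := by
    simp only [tripleProduct_eq, PiLp.neg_apply]; ring
  have e2 : tripleProduct (A s) (-v) (C s) = -tripleProduct (C s) (A s) v := by
    simp only [tripleProduct_eq, PiLp.neg_apply]; ring
  have e3 : tripleProduct (A s) (B s) (-v) = -tripleProduct (A s) (B s) v := by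
    simp only [tripleProduct_eq, PiLp.neg_apply]; ring
  rw [angleNum, Complex.mk_div_mk_im, hsq, e1, e2, e3]
  simp only [edgeTerm, angleRe, inner_neg_right, inner_neg_left, Pi.mul_apply]
  rw [real_inner_comm (A s) v, real_inner_comm (B s) v, real_inner_comm (C s) v]
  simp only [real_inner_self_eq_norm_sq] at hα hβ hγ
  rw [real_inner_comm (C s) (A s)] at hα
  rw [real_inner_comm (A s) (B s)] at hβ
  rw [real_inner_comm (B s) (C s)] at hγ
  generalize ‖A s‖ = a at *
  generalize ‖B s‖ = b at *
  generalize ‖C s‖ = c at *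
  generalize ⟪A s, B s⟫ = x at *
  generalize ⟪B s, C s⟫ = y at *
  generalize ⟪C s, A s⟫ = z at *
  generalize ⟪A s, v⟫ = α at *
  generalize ⟪B s, v⟫ = β at *
  generalize ⟪C s, v⟫ = γ at *
  generalize tripleProduct (A s) (B s) (C s) = D at *
  generalize tripleProduct (A s) (B s) v = r at *
  generalize tripleProduct (B s) (C s) v = p at *
  generalize tripleProduct (C s) (A s) v = q at *
  clear dN dD e1 e2 e3 hsq
  trans (r * (1 / a + 1 / b) * (b * c + y) * (c * a + z)
      + p * (1 / b + 1 / c) * (c * a + z) * (a * b + x)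
      + q * (1 / c + 1 / a) * (a * b + x) * (b * c + y))
      / (2 * (a * b + x) * (b * c + y) * (c * a + z))
  · congr 1
    -- The multipliers are the coefficients of `α`, `β`, `γ` in minus the derivative of `angleRe`;
    -- Cramer's rule then replaces `D * α`, `D * β`, `D * γ`.
    linear_combination (norm := (field_simp; ring)) (b * c / a + y / a + c + b) * hα
      + (a * c / b + z / b + c + a) * hβ + (a * b / c + x / c + a + b) * hγ
  · generalize a * b + x = X at *
    generalize b * c + y = Y at *
    generalize c * a + z = Z at *
    field_simp
    ring

/-! ### The Gauss integral of two segments. -/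

/-- Six times the signed volume of the tetrahedron with vertices `x, p, q, r`. -/
noncomputable def tetVolume (x p q r : E3) : ℝ := tripleProduct (p - x) (q - x) (r - x)

lemma lineMap_apply_coords (p q : E3) (s : ℝ) (i : Fin 3) :
    AffineMap.lineMap (k := ℝ) p q s i = p i + s * (q i - p i) := by
  simp [AffineMap.lineMap_apply]
  ring

/-- The volume spanned by a segment of a line and a further segment does not change when the
segment slides along the line. -/
lemma tripleProduct_sub_lineMap (p₀ p₁ q₀ q₁ : E3) (s : ℝ) :
    tripleProduct (q₀ - AffineMap.lineMap (k := ℝ) p₀ p₁ s)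
      (q₁ - AffineMap.lineMap (k := ℝ) p₀ p₁ s) (p₁ - p₀) = tetVolume p₀ q₀ q₁ p₁ := by
  simp only [tetVolume, tripleProduct_eq, PiLp.sub_apply, lineMap_apply_coords]
  ring

lemma tetVolume_lineMap (p₀ p₁ q₀ q₁ q₂ : E3) (s : ℝ) :
    tetVolume (AffineMap.lineMap (k := ℝ) p₀ p₁ s) q₀ q₁ q₂
      = (1 - s) * tetVolume p₀ q₀ q₁ q₂ + s * tetVolume p₁ q₀ q₁ q₂ := by
  simp only [tetVolume, tripleProduct_eq, PiLp.sub_apply, lineMap_apply_coords]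
  ring

lemma tripleProduct_add_smul_sub (A B v : E3) (t : ℝ) :
    tripleProduct (A + t • (B - A)) (B - A) v = tripleProduct A B v := by
  simp only [tripleProduct_eq, PiLp.sub_apply, PiLp.add_apply, PiLp.smul_apply, smul_eq_mul]
  ring

/-- The cross product of a point of the line with the direction of the line does not depend on the
point. -/
lemma gram_sub_invariant (A B : E3) (t : ℝ) :
    ‖A + t • (B - A)‖ ^ 2 * ‖B - A‖ ^ 2 - ⟪A + t • (B - A), B - A⟫ ^ 2
      = ‖A‖ ^ 2 * ‖B‖ ^ 2 - ⟪A, B⟫ ^ 2 := by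
  simp only [norm_sq_eq_coords, inner_eq_coords, PiLp.sub_apply, PiLp.add_apply, PiLp.smul_apply,
    smul_eq_mul]
  ring

lemma integral_inv_norm_cube {A B v : E3} (h : tripleProduct A B v ≠ 0) :
    ∫ t in (0 : ℝ)..1, 1 / ‖A + t • (B - A)‖ ^ 3
      = (‖A‖ + ‖B‖) / (‖A‖ * ‖B‖ * (‖A‖ * ‖B‖ + ⟪A, B⟫)) := by
  have hpos (t : ℝ) : 0 < ‖A + t • (B - A)‖ := by
    rw [← tripleProduct_add_smul_sub A B v t] at h
    exact (norm_pos_of_tripleProduct_ne_zero h).1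
  obtain ⟨ha, hb⟩ := norm_pos_of_tripleProduct_ne_zero h
  have hlt := inner_sq_lt_of_tripleProduct_ne_zero h
  have hx := norm_mul_norm_add_inner_pos h
  have hK : 0 < ‖A‖ ^ 2 * ‖B‖ ^ 2 - ⟪A, B⟫ ^ 2 := by rw [mul_pow] at hlt; linarith
  -- With `W` the moving point and `K` the constant Gram determinant, an antiderivative of `1 / ‖W‖
  -- ^ 3` is `⟪W, B - A⟫ / (K * ‖W‖)`.
  have hder (t : ℝ) : HasDerivAt (fun t : ℝ => ⟪A + t • (B - A), B - A⟫
      / ((‖A‖ ^ 2 * ‖B‖ ^ 2 - ⟪A, B⟫ ^ 2) * ‖A + t • (B - A)‖)) (1 / ‖A + t • (B - A)‖ ^ 3) t := by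
    have hW : HasDerivAt (fun t : ℝ => A + t • (B - A)) (B - A) t := by
      simpa using ((hasDerivAt_id t).smul_const (B - A)).const_add A
    have hn := hasDerivAt_norm hW (hpos t)
    have hi := hW.inner ℝ (hasDerivAt_const t (B - A))
    refine (hi.div (hn.const_mul (‖A‖ ^ 2 * ‖B‖ ^ 2 - ⟪A, B⟫ ^ 2))
      (mul_pos hK (hpos t)).ne').congr_deriv ?_
    have hg := gram_sub_invariant A B t
    have hp := hpos t
    rw [inner_zero_right, real_inner_self_eq_norm_sq]
    generalize ‖A‖ ^ 2 * ‖B‖ ^ 2 - ⟪A, B⟫ ^ 2 = K at *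
    generalize ⟪A + t • (B - A), B - A⟫ = g at *
    generalize ‖A + t • (B - A)‖ = n at *
    field_simp
    linear_combination hg
  rw [intervalIntegral.integral_eq_sub_of_hasDerivAt (fun t _ => hder t)]
  · have h1 : ⟪A + (1 : ℝ) • (B - A), B - A⟫ = ‖B‖ ^ 2 - ⟪A, B⟫ := by
      simp only [norm_sq_eq_coords, inner_eq_coords, PiLp.sub_apply, PiLp.add_apply,
        PiLp.smul_apply, smul_eq_mul]
      ring
    have h0 : ⟪A + (0 : ℝ) • (B - A), B - A⟫ = ⟪A, B⟫ - ‖A‖ ^ 2 := by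
      simp only [norm_sq_eq_coords, inner_eq_coords, PiLp.sub_apply, PiLp.add_apply,
        PiLp.smul_apply, smul_eq_mul]
      ring
    rw [h1, h0]
    simp only [one_smul, zero_smul, add_zero, add_sub_cancel]
    have hy : 0 < ‖A‖ * ‖B‖ - ⟪A, B⟫ := by
      have : ‖A‖ ^ 2 * ‖B‖ ^ 2 - ⟪A, B⟫ ^ 2
        = (‖A‖ * ‖B‖ + ⟪A, B⟫) * (‖A‖ * ‖B‖ - ⟪A, B⟫) := by ring
      rw [this] at hK
      exact (mul_pos_iff_of_pos_left hx).1 hK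
    have : ‖A‖ ^ 2 * ‖B‖ ^ 2 - ⟪A, B⟫ ^ 2
        = (‖A‖ * ‖B‖ + ⟪A, B⟫) * (‖A‖ * ‖B‖ - ⟪A, B⟫) := by ring
    rw [this]
    generalize ‖A‖ * ‖B‖ + ⟪A, B⟫ = X at *
    have hxy : ⟪A, B⟫ = ‖A‖ * ‖B‖ - (‖A‖ * ‖B‖ - ⟪A, B⟫) := by ring
    generalize ‖A‖ * ‖B‖ - ⟪A, B⟫ = Y at *
    rw [hxy]
    field_simp
    ring
  · apply Continuous.intervalIntegrable
    exact continuous_const.div (by fun_prop) fun t => (pow_pos (hpos t) 3).ne'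

lemma hasDerivAt_lineMap_E3 (p q : E3) (s : ℝ) :
    HasDerivAt (fun s : ℝ => AffineMap.lineMap (k := ℝ) p q s) (q - p) s := by
  simpa using AffineMap.hasDerivAt_lineMap (a := p) (b := q) (x := s)

lemma gaussIntegral_lineMap {p₀ p₁ q₀ q₁ : E3} (h : tetVolume p₀ q₀ q₁ p₁ ≠ 0) :
    gaussIntegral (fun s => AffineMap.lineMap p₀ p₁ s) (fun t => AffineMap.lineMap q₀ q₁ t)
      = ∫ s in (0 : ℝ)..1, edgeTerm (q₀ - AffineMap.lineMap (k := ℝ) p₀ p₁ s)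
          (q₁ - AffineMap.lineMap (k := ℝ) p₀ p₁ s) (p₁ - p₀) := by
  rw [gaussIntegral]
  congr 1 with s
  have hs := tripleProduct_sub_lineMap p₀ p₁ q₀ q₁ s
  rw [edgeTerm, ← integral_inv_norm_cube (v := p₁ - p₀) (by rwa [hs]),
    ← intervalIntegral.integral_const_mul]
  congr 1 with t
  rw [(hasDerivAt_lineMap_E3 p₀ p₁ s).deriv, (hasDerivAt_lineMap_E3 q₀ q₁ t).deriv, mul_one_div]
  have hW : AffineMap.lineMap (k := ℝ) p₀ p₁ s - AffineMap.lineMap (k := ℝ) q₀ q₁ t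
      = -((q₀ - AffineMap.lineMap (k := ℝ) p₀ p₁ s) + t • ((q₁ - AffineMap.lineMap (k := ℝ) p₀ p₁ s)
        - (q₀ - AffineMap.lineMap (k := ℝ) p₀ p₁ s))) := by
    ext i
    simp only [PiLp.sub_apply, PiLp.add_apply, PiLp.smul_apply, PiLp.neg_apply, smul_eq_mul,
      lineMap_apply_coords]
    ring
  rw [hW, norm_neg, ← hW]
  congr 1
  simp only [tripleProduct_eq, PiLp.sub_apply, lineMap_apply_coords]
  ring

lemma continuous_edgeTerm {A B : ℝ → E3} {v : E3} (hA : Continuous A) (hB : Continuous B)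
    (h : ∀ s, tripleProduct (A s) (B s) v ≠ 0) : Continuous fun s => edgeTerm (A s) (B s) v := by
  unfold edgeTerm
  refine Continuous.mul ?_ (Continuous.div (by fun_prop) (by fun_prop) fun s => ?_)
  · simp only [tripleProduct_eq]
    fun_prop
  · obtain ⟨ha, hb⟩ := norm_pos_of_tripleProduct_ne_zero (h s)
    have := norm_mul_norm_add_inner_pos (h s)
    positivity

/-- An antiderivative of the logarithmic derivative of a curve in the slit plane. -/
lemma integral_eq_arg_sub_arg {Z Z' : ℝ → ℂ} {g : ℝ → ℝ} (hg : Continuous g)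
    (hZ : ∀ s, HasDerivAt Z (Z' s) s) (hZg : ∀ s, (Z' s / Z s).im = g s)
    (hslit : ∀ s ∈ Set.Icc (0 : ℝ) 1, Z s ∈ Complex.slitPlane) :
    ∫ s in (0 : ℝ)..1, g s = (Z 1).arg - (Z 0).arg := by
  simp only [← Complex.log_im]
  refine intervalIntegral.integral_eq_sub_of_hasDerivAt (f := fun s => (Complex.log (Z s)).im)
    (fun s hs => ?_) (hg.intervalIntegrable _ _)
  rw [Set.uIcc_of_le zero_le_one] at hs
  rw [← hZg]
  exact Complex.imCLM.hasFDerivAt.comp_hasDerivAt s ((hZ s).clog_real (hslit s hs))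

/-! ### The sign of the real part in the plane of the triangle. -/

section Weights
variable {l m n a b c x y z : ℝ}

/-- The hypotheses are the inner products of `l • A + m • B + n • C = 0` with `A`, `B`, `C`. The
vectors `l • A`, `m • B`, `n • C` close up to a triangle with signed side lengths `l * a`, `m * b`,
`n * c`; the law of cosines (`e1`, `e2`, `e3`) turns the real part into a Heron-type product. -/
lemma weights_identity (h1 : l * a ^ 2 + m * x + n * z = 0) (h2 : l * x + m * b ^ 2 + n * y = 0)
    (h3 : l * z + m * y + n * c ^ 2 = 0) :
    2 * (l * m * n) * (a * b * c + x * c + y * a + z * b)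
      = -((m * b + n * c - l * a) * (l * a + n * c - m * b) * (l * a + m * b - n * c)) := by
  have e1 : 2 * l * m * x = (n * c) ^ 2 - (l * a) ^ 2 - (m * b) ^ 2 := by
    linear_combination l * h1 + m * h2 - n * h3
  have e2 : 2 * m * n * y = (l * a) ^ 2 - (m * b) ^ 2 - (n * c) ^ 2 := by
    linear_combination m * h2 + n * h3 - l * h1
  have e3 : 2 * l * n * z = (m * b) ^ 2 - (l * a) ^ 2 - (n * c) ^ 2 := by
    linear_combination l * h1 + n * h3 - m * h2
  linear_combination n * c * e1 + l * a * e2 + m * b * e3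

lemma weights_mul (h1 : l * a ^ 2 + m * x + n * z = 0) (h2 : l * x + m * b ^ 2 + n * y = 0)
    (h3 : l * z + m * y + n * c ^ 2 = 0) :
    2 * (l * m) * (a * b + x) = (m * b + n * c - l * a) * (l * a + n * c - m * b) := by
  linear_combination l * h1 + m * h2 - n * h3

/-- For positive weights the three factors in `weights_identity` are positive, as in the strict
triangle inequality. By `weights_mul` two factors share a sign, and their sum is positive. -/
lemma neg_of_weights_pos (ha : 0 < a) (hb : 0 < b) (hc : 0 < c)
    (hx : 0 < a * b + x) (hy : 0 < b * c + y)
    (h1 : l * a ^ 2 + m * x + n * z = 0) (h2 : l * x + m * b ^ 2 + n * y = 0)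
    (h3 : l * z + m * y + n * c ^ 2 = 0) (hl : 0 < l) (hm : 0 < m) (hn : 0 < n) :
    a * b * c + x * c + y * a + z * b < 0 := by
  have k := weights_identity h1 h2 h3
  have k1 := weights_mul h1 h2 h3
  have k2 := weights_mul (l := m) (m := n) (n := l) (a := b) (b := c) (c := a) (x := y) (y := z)
    (z := x) (by linarith) (by linarith) (by linarith)
  have p1 : 0 < 2 * (l * m) * (a * b + x) := by positivity
  have p2 : 0 < 2 * (m * n) * (b * c + y) := by positivity
  have la : 0 < l * a := by positivity
  have mb : 0 < m * b := by positivity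
  have nc : 0 < n * c := by positivity
  rw [k1] at p1
  rw [k2] at p2
  have q2 : 0 < l * a + n * c - m * b := by
    by_contra! hle
    have := neg_of_mul_pos_left p1 hle
    linarith
  have q1 := pos_of_mul_pos_left p1 q2.le
  have q3 : 0 < l * a + m * b - n * c := by nlinarith
  have : 0 < l * m * n := by positivity
  have : 0 < (m * b + n * c - l * a) * (l * a + n * c - m * b) * (l * a + m * b - n * c) := by
    positivity
  by_contra! hle
  nlinarith [mul_nonneg (show 0 ≤ 2 * (l * m * n) by positivity) hle]

/-- Here the two factors of `weights_mul` share a sign but have sum `2 * n * c < 0`, so both are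
negative and the third is positive. -/
lemma pos_of_weights_pos_pos_neg (ha : 0 < a) (hb : 0 < b) (hc : 0 < c)
    (hx : 0 < a * b + x)
    (h1 : l * a ^ 2 + m * x + n * z = 0) (h2 : l * x + m * b ^ 2 + n * y = 0)
    (h3 : l * z + m * y + n * c ^ 2 = 0) (hl : 0 < l) (hm : 0 < m) (hn : n < 0) :
    0 < a * b * c + x * c + y * a + z * b := by
  have k := weights_identity h1 h2 h3
  have k1 := weights_mul h1 h2 h3
  have p1 : 0 < 2 * (l * m) * (a * b + x) := by positivity
  have la : 0 < l * a := by positivity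
  have mb : 0 < m * b := by positivity
  have nc : n * c < 0 := mul_neg_of_neg_of_pos hn hc
  rw [k1] at p1
  have q2 : l * a + n * c - m * b < 0 := by
    by_contra! hle
    have := pos_of_mul_pos_left p1 hle
    linarith
  have q1 := neg_of_mul_pos_left p1 q2.le
  have q3 : 0 < l * a + m * b - n * c := by linarith
  have hneg : l * m * n < 0 := mul_neg_of_pos_of_neg (by positivity) hn
  have : 0 < (m * b + n * c - l * a) * (l * a + n * c - m * b) * (l * a + m * b - n * c) :=
    mul_pos p1 q3
  by_contra! hle
  nlinarith [mul_nonneg_of_nonpos_of_nonpos hneg.le hle]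

/-- Cyclic rotation and a global change of sign reduce every mixed pattern to
`pos_of_weights_pos_pos_neg`. -/
lemma pos_of_weights_mixed (ha : 0 < a) (hb : 0 < b) (hc : 0 < c)
    (hx : 0 < a * b + x) (hy : 0 < b * c + y) (hz : 0 < c * a + z)
    (h1 : l * a ^ 2 + m * x + n * z = 0) (h2 : l * x + m * b ^ 2 + n * y = 0)
    (h3 : l * z + m * y + n * c ^ 2 = 0) (hl : l ≠ 0) (hm : m ≠ 0) (hn : n ≠ 0)
    (hsum : l + m + n = 1) (hmix : ¬ (0 < l ∧ 0 < m ∧ 0 < n)) :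
    0 < a * b * c + x * c + y * a + z * b := by
  rcases hl.lt_or_gt with hl | hl <;> rcases hm.lt_or_gt with hm | hm <;>
    rcases hn.lt_or_gt with hn | hn
  · linarith
  · exact pos_of_weights_pos_pos_neg (l := -l) (m := -m) (n := -n) ha hb hc hx
      (by linarith) (by linarith) (by linarith) (by linarith) (by linarith) (by linarith)
  · linarith [pos_of_weights_pos_pos_neg (l := -n) (m := -l) (n := -m) (y := x) (z := y) hc ha hb hz
      (by linarith) (by linarith) (by linarith) (by linarith) (by linarith) (by linarith)]
  · linarith [pos_of_weights_pos_pos_neg (l := m) (m := n) (n := l) (y := z) (z := x) hb hc ha hy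
      (by linarith) (by linarith) (by linarith) (by linarith) (by linarith) (by linarith)]
  · linarith [pos_of_weights_pos_pos_neg (l := -m) (m := -n) (n := -l) (y := z) (z := x) hb hc ha hy
      (by linarith) (by linarith) (by linarith) (by linarith) (by linarith) (by linarith)]
  · linarith [pos_of_weights_pos_pos_neg (l := n) (m := l) (n := m) (y := x) (z := y) hc ha hb hz
      (by linarith) (by linarith) (by linarith) (by linarith) (by linarith) (by linarith)]
  · exact pos_of_weights_pos_pos_neg ha hb hc hx h1 h2 h3 hl hm hn
  · exact absurd ⟨hl, hm, hn⟩ hmix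

end Weights

lemma exists_weights {A B C : E3} (h : tripleProduct A B C = 0) :
    ∃ l m n : ℝ, (l ≠ 0 ∨ m ≠ 0 ∨ n ≠ 0) ∧ l • A + m • B + n • C = 0 := by
  obtain ⟨w, hw, hM⟩ := Matrix.exists_vecMul_eq_zero_iff.2 h
  refine ⟨w 0, w 1, w 2, ?_, ?_⟩
  · by_contra! hc
    apply hw
    ext i
    fin_cases i <;> simp [hc]
  · ext i
    have := congrFun hM i
    fin_cases i <;> simpa [Matrix.vecMul, dotProduct, Fin.sum_univ_three] using this

lemma weight_mul_tripleProduct {A B C : E3} {l m n : ℝ} (h : l • A + m • B + n • C = 0) :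
    l * tripleProduct A B C = 0 ∧ m * tripleProduct A B C = 0 ∧ n * tripleProduct A B C = 0 := by
  have h0 := congrArg (fun u : E3 => u 0) h
  have h1 := congrArg (fun u : E3 => u 1) h
  have h2 := congrArg (fun u : E3 => u 2) h
  simp only [PiLp.add_apply, PiLp.smul_apply, PiLp.zero_apply, smul_eq_mul] at h0 h1 h2
  simp only [tripleProduct_eq]
  refine ⟨?_, ?_, ?_⟩
  · linear_combination (B 1 * C 2 - B 2 * C 1) * h0 - (B 0 * C 2 - B 2 * C 0) * h1
      + (B 0 * C 1 - B 1 * C 0) * h2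
  · linear_combination (C 1 * A 2 - C 2 * A 1) * h0 - (C 0 * A 2 - C 2 * A 0) * h1
      + (C 0 * A 1 - C 1 * A 0) * h2
  · linear_combination (A 1 * B 2 - A 2 * B 1) * h0 - (A 0 * B 2 - A 2 * B 0) * h1
      + (A 0 * B 1 - A 1 * B 0) * h2

lemma weight_ne_zero {A B C v : E3} {l m n : ℝ} (h : l • A + m • B + n • C = 0)
    (hlmn : l ≠ 0 ∨ m ≠ 0 ∨ n ≠ 0) (hAB : tripleProduct A B v ≠ 0) : n ≠ 0 := by
  rintro rfl
  -- With `n = 0` the third vector is free, so `v` can take the place of `C`.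
  have h' : l • A + m • B + (0 : ℝ) • v = 0 := by simpa using h
  obtain ⟨h1, h2, -⟩ := weight_mul_tripleProduct h'
  simp_all

lemma weights_inner {A B C : E3} {l m n : ℝ} (h : l • A + m • B + n • C = 0) :
    l * ‖A‖ ^ 2 + m * ⟪A, B⟫ + n * ⟪C, A⟫ = 0 ∧ l * ⟪A, B⟫ + m * ‖B‖ ^ 2 + n * ⟪B, C⟫ = 0 ∧
      l * ⟪C, A⟫ + m * ⟪B, C⟫ + n * ‖C‖ ^ 2 = 0 := by
  have key (w : E3) : l * ⟪w, A⟫ + m * ⟪w, B⟫ + n * ⟪w, C⟫ = 0 := by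
    rw [← inner_zero_right (𝕜 := ℝ) w, ← h]
    simp [inner_add_right, inner_smul_right]
  have hA := key A
  have hB := key B
  have hC := key C
  rw [real_inner_self_eq_norm_sq] at hA hB hC
  rw [real_inner_comm C A] at hA
  rw [real_inner_comm A B] at hB
  rw [real_inner_comm B C] at hC
  exact ⟨hA, hB, hC⟩

lemma mem_convexHull_triple {q₀ q₁ q₂ x : E3} : x ∈ convexHull ℝ {q₀, q₁, q₂} ↔
    ∃ l m n : ℝ, 0 ≤ l ∧ 0 ≤ m ∧ 0 ≤ n ∧ l + m + n = 1 ∧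
      l • (q₀ - x) + m • (q₁ - x) + n • (q₂ - x) = 0 := by
  have rel {l m n : ℝ} (h : l + m + n = 1) : l • (q₀ - x) + m • (q₁ - x) + n • (q₂ - x)
      = (l • q₀ + m • q₁ + n • q₂) - x := by
    calc _ = (l • q₀ + m • q₁ + n • q₂) - (l + m + n) • x := by module
      _ = _ := by rw [h, one_smul]
  rw [convexHull_insert (Set.insert_nonempty _ _), convexHull_pair]
  simp only [convexJoin_singleton_left, Set.mem_iUnion, segment, Set.mem_ofPred_eq]
  constructor
  · rintro ⟨w, ⟨s, t, hs, ht, hst, rfl⟩, u, r, hu, hr, hur, rfl⟩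
    have hsum : u + r * s + r * t = 1 := by linear_combination hur + r * hst
    refine ⟨u, r * s, r * t, hu, by positivity, by positivity, hsum, ?_⟩
    rw [rel hsum]
    module
  · rintro ⟨l, m, n, hl, hm, hn, hsum, h⟩
    rw [rel hsum, sub_eq_zero] at h
    rcases (add_nonneg hm hn).eq_or_lt with h0 | h0
    · obtain rfl : m = 0 := by linarith
      obtain rfl : n = 0 := by linarith
      -- The point is the vertex `q₀`; any point of the opposite side would serve.
      exact ⟨q₁, ⟨1, 0, by norm_num, le_rfl, by norm_num, by simp⟩, l, 0, hl, le_rfl,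
        by linarith, by rw [← h]; simp⟩
    · refine ⟨(m / (m + n)) • q₁ + (n / (m + n)) • q₂,
        ⟨_, _, by positivity, by positivity, by field_simp, rfl⟩, l, m + n, hl, h0.le,
        by linarith, ?_⟩
      rw [← h, smul_add, smul_smul, smul_smul, mul_div_cancel₀ _ h0.ne',
        mul_div_cancel₀ _ h0.ne', add_assoc]

lemma tetVolume_eq_zero_of_mem_convexHull {q₀ q₁ q₂ x : E3}
    (hx : x ∈ convexHull ℝ {q₀, q₁, q₂}) : tetVolume x q₀ q₁ q₂ = 0 := by
  obtain ⟨l, m, n, -, -, -, hsum, h⟩ := mem_convexHull_triple.1 hx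
  obtain ⟨h1, h2, h3⟩ := weight_mul_tripleProduct h
  rw [tetVolume]
  linear_combination h1 + h2 + h3 - tripleProduct (q₀ - x) (q₁ - x) (q₂ - x) * hsum

section Sign
variable {q₀ q₁ q₂ x v : E3}

lemma angleRe_neg_of_mem_convexHull
    (h01 : tripleProduct (q₀ - x) (q₁ - x) v ≠ 0) (h12 : tripleProduct (q₁ - x) (q₂ - x) v ≠ 0)
    (h20 : tripleProduct (q₂ - x) (q₀ - x) v ≠ 0) (hx : x ∈ convexHull ℝ {q₀, q₁, q₂}) :
    angleRe (q₀ - x) (q₁ - x) (q₂ - x) < 0 := by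
  obtain ⟨l, m, n, hl, hm, hn, hsum, h⟩ := mem_convexHull_triple.1 hx
  have hne : l ≠ 0 ∨ m ≠ 0 ∨ n ≠ 0 := by
    by_contra! hc
    linarith [hc.1, hc.2.1, hc.2.2]
  have hn' := weight_ne_zero h hne h01
  have hl' := weight_ne_zero (A := q₁ - x) (B := q₂ - x) (C := q₀ - x) (l := m) (m := n) (n := l)
    (by rw [← h]; abel) (by tauto) h12
  have hm' := weight_ne_zero (A := q₂ - x) (B := q₀ - x) (C := q₁ - x) (l := n) (m := l) (n := m)
    (by rw [← h]; abel) (by tauto) h20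
  obtain ⟨h1, h2, h3⟩ := weights_inner h
  obtain ⟨ha, hb⟩ := norm_pos_of_tripleProduct_ne_zero h01
  obtain ⟨-, hc⟩ := norm_pos_of_tripleProduct_ne_zero h12
  exact neg_of_weights_pos ha hb hc (norm_mul_norm_add_inner_pos h01)
    (norm_mul_norm_add_inner_pos h12) h1 h2 h3
    (hl.lt_of_ne' hl') (hm.lt_of_ne' hm') (hn.lt_of_ne' hn')

lemma angleRe_pos_of_notMem_convexHull
    (h01 : tripleProduct (q₀ - x) (q₁ - x) v ≠ 0) (h12 : tripleProduct (q₁ - x) (q₂ - x) v ≠ 0)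
    (h20 : tripleProduct (q₂ - x) (q₀ - x) v ≠ 0) (hx : x ∉ convexHull ℝ {q₀, q₁, q₂})
    (h0 : tetVolume x q₀ q₁ q₂ = 0) {p : E3} (hp : tetVolume p q₀ q₁ q₂ ≠ 0) :
    0 < angleRe (q₀ - x) (q₁ - x) (q₂ - x) := by
  obtain ⟨l, m, n, hne, h⟩ := exists_weights h0
  -- A relation with weights of sum zero is translation invariant, so it would also hold as seen
  -- from `p`, which is off the plane.
  have hs : l + m + n ≠ 0 := by
    intro hs
    have hp' : l • (q₀ - p) + m • (q₁ - p) + n • (q₂ - p) = 0 := by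
      calc _ = (l • (q₀ - x) + m • (q₁ - x) + n • (q₂ - x)) + (l + m + n) • (x - p) := by module
        _ = 0 := by rw [h, hs]; simp
    obtain ⟨h1, h2, h3⟩ := weight_mul_tripleProduct hp'
    rw [← tetVolume] at h1 h2 h3
    simp_all
  wlog hsum : l + m + n = 1 generalizing l m n
  · refine this (l / (l + m + n)) (m / (l + m + n)) (n / (l + m + n)) ?_ ?_ ?_ ?_
    · simpa [hs] using hne
    · calc _ = (l + m + n)⁻¹ • (l • (q₀ - x) + m • (q₁ - x) + n • (q₂ - x)) := by
            simp only [div_eq_inv_mul, mul_smul, smul_add]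
        _ = 0 := by rw [h, smul_zero]
    · rw [← add_div, ← add_div, div_self hs]
      exact one_ne_zero
    · rw [← add_div, ← add_div, div_self hs]
  have hn' := weight_ne_zero h hne h01
  have hl' := weight_ne_zero (A := q₁ - x) (B := q₂ - x) (C := q₀ - x) (l := m) (m := n) (n := l)
    (by rw [← h]; abel) (by tauto) h12
  have hm' := weight_ne_zero (A := q₂ - x) (B := q₀ - x) (C := q₁ - x) (l := n) (m := l) (n := m)
    (by rw [← h]; abel) (by tauto) h20
  obtain ⟨h1, h2, h3⟩ := weights_inner h
  obtain ⟨ha, hb⟩ := norm_pos_of_tripleProduct_ne_zero h01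
  obtain ⟨-, hc⟩ := norm_pos_of_tripleProduct_ne_zero h12
  refine pos_of_weights_mixed ha hb hc (norm_mul_norm_add_inner_pos h01)
    (norm_mul_norm_add_inner_pos h12) (norm_mul_norm_add_inner_pos h20) h1 h2 h3 hl' hm' hn' hsum ?_
  rintro ⟨hl, hm, hn⟩
  exact hx (mem_convexHull_triple.2 ⟨l, m, n, hl.le, hm.le, hn.le, hsum, h⟩)

end Sign

/-! ### One edge against a triangle: the jump of the solid angle. -/

/-- The argument of `angleNum` at a point of observation: half the solid angle of the triangle. -/
noncomputable def halfAngle (x q₀ q₁ q₂ : E3) : ℝ :=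
  (angleNum (q₀ - x) (q₁ - x) (q₂ - x)).arg

open Classical in
/-- The signed number of intersections of the oriented segment from `p₀` to `p₁` with the
triangle with vertices `q₀, q₁, q₂`. -/
noncomputable def signedHit (p₀ p₁ q₀ q₁ q₂ : E3) : ℝ :=
  if (segment ℝ p₀ p₁ ∩ convexHull ℝ {q₀, q₁, q₂}).Nonempty then
    if 0 < tetVolume p₀ q₀ q₁ q₂ then 1 else -1
  else 0

section Edge
variable {p₀ p₁ q₀ q₁ q₂ : E3}

lemma mem_segment_iff_lineMap {x : E3} : x ∈ segment ℝ p₀ p₁ ↔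
    ∃ s ∈ Set.Icc (0 : ℝ) 1, AffineMap.lineMap (k := ℝ) p₀ p₁ s = x := by
  rw [segment_eq_image_lineMap, Set.mem_image]

/-- An edge that meets the triangle has its ends on different sides of the triangle's plane. -/
lemma tetVolume_mul_neg_of_hit (h0 : tetVolume p₀ q₀ q₁ q₂ ≠ 0) (h1 : tetVolume p₁ q₀ q₁ q₂ ≠ 0)
    (hhit : (segment ℝ p₀ p₁ ∩ convexHull ℝ {q₀, q₁, q₂}).Nonempty) :
    tetVolume p₀ q₀ q₁ q₂ * tetVolume p₁ q₀ q₁ q₂ < 0 := by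
  obtain ⟨x, hx, hx'⟩ := hhit
  obtain ⟨s, ⟨hs0, hs1⟩, rfl⟩ := mem_segment_iff_lineMap.1 hx
  have h := tetVolume_eq_zero_of_mem_convexHull hx'
  rw [tetVolume_lineMap] at h
  by_contra! hle
  have hpos := hle.lt_of_ne' (mul_ne_zero h0 h1)
  have e1 : (1 - s) * tetVolume p₀ q₀ q₁ q₂ ^ 2
      + s * (tetVolume p₀ q₀ q₁ q₂ * tetVolume p₁ q₀ q₁ q₂) = 0 := by
    linear_combination tetVolume p₀ q₀ q₁ q₂ * h
  have hsq : 0 < tetVolume p₀ q₀ q₁ q₂ ^ 2 := by positivity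
  rcases hs1.eq_or_lt with rfl | hs1
  · linarith
  · have := mul_pos (sub_pos.2 hs1) hsq
    have := mul_nonneg hs0 hpos.le
    linarith

lemma continuous_edgeTerm_lineMap (h : tetVolume p₀ q₀ q₁ p₁ ≠ 0) :
    Continuous fun s => edgeTerm (q₀ - AffineMap.lineMap (k := ℝ) p₀ p₁ s)
      (q₁ - AffineMap.lineMap (k := ℝ) p₀ p₁ s) (p₁ - p₀) :=
  continuous_edgeTerm (continuous_const.sub AffineMap.lineMap_continuous)
    (continuous_const.sub AffineMap.lineMap_continuous)
    fun s => by rwa [tripleProduct_sub_lineMap]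

/-- The Gauss integral of an edge with a triangle. -/
lemma sum_gaussIntegral_lineMap (h01 : tetVolume p₀ q₀ q₁ p₁ ≠ 0)
    (h12 : tetVolume p₀ q₁ q₂ p₁ ≠ 0) (h20 : tetVolume p₀ q₂ q₀ p₁ ≠ 0)
    (h0 : tetVolume p₀ q₀ q₁ q₂ ≠ 0) (h1 : tetVolume p₁ q₀ q₁ q₂ ≠ 0) :
    gaussIntegral (fun s => AffineMap.lineMap p₀ p₁ s) (fun t => AffineMap.lineMap q₀ q₁ t)
      + gaussIntegral (fun s => AffineMap.lineMap p₀ p₁ s) (fun t => AffineMap.lineMap q₁ q₂ t)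
      + gaussIntegral (fun s => AffineMap.lineMap p₀ p₁ s) (fun t => AffineMap.lineMap q₂ q₀ t)
      = 2 * (halfAngle p₁ q₀ q₁ q₂ - halfAngle p₀ q₀ q₁ q₂
          + 2 * Real.pi * signedHit p₀ p₁ q₀ q₁ q₂) := by
  have c01 := continuous_edgeTerm_lineMap h01
  have c12 := continuous_edgeTerm_lineMap h12
  have c20 := continuous_edgeTerm_lineMap h20
  rw [gaussIntegral_lineMap h01, gaussIntegral_lineMap h12, gaussIntegral_lineMap h20,
    ← intervalIntegral.integral_add (c01.intervalIntegrable _ _) (c12.intervalIntegrable _ _),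
    ← intervalIntegral.integral_add (Continuous.intervalIntegrable (by exact c01.add c12) _ _)
      (c20.intervalIntegrable _ _)]
  rw [mul_comm (2 : ℝ) (_ + _), ← div_eq_iff two_ne_zero, ← intervalIntegral.integral_div]
  have cg := ((c01.add c12).add c20).div_const 2
  have hA (q : E3) (s : ℝ) :
      HasDerivAt (fun s => q - AffineMap.lineMap (k := ℝ) p₀ p₁ s) (-(p₁ - p₀)) s :=
    (hasDerivAt_lineMap_E3 p₀ p₁ s).const_sub q
  have n01 (s : ℝ) := (tripleProduct_sub_lineMap p₀ p₁ q₀ q₁ s).trans_ne h01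
  have n12 (s : ℝ) := (tripleProduct_sub_lineMap p₀ p₁ q₁ q₂ s).trans_ne h12
  have n20 (s : ℝ) := (tripleProduct_sub_lineMap p₀ p₁ q₂ q₀ s).trans_ne h20
  choose Z' hZ' hg using fun s =>
    angleNum_logDeriv (hA q₀ s) (hA q₁ s) (hA q₂ s) (n01 s) (n12 s) (n20 s)
  have hZ0 : halfAngle p₀ q₀ q₁ q₂ = (angleNum (q₀ - AffineMap.lineMap (k := ℝ) p₀ p₁ (0 : ℝ))
      (q₁ - AffineMap.lineMap (k := ℝ) p₀ p₁ (0 : ℝ))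
      (q₂ - AffineMap.lineMap (k := ℝ) p₀ p₁ (0 : ℝ))).arg := by
    simp [halfAngle]
  have hZ1 : halfAngle p₁ q₀ q₁ q₂ = (angleNum (q₀ - AffineMap.lineMap (k := ℝ) p₀ p₁ (1 : ℝ))
      (q₁ - AffineMap.lineMap (k := ℝ) p₀ p₁ (1 : ℝ))
      (q₂ - AffineMap.lineMap (k := ℝ) p₀ p₁ (1 : ℝ))).arg := by
    simp [halfAngle]
  by_cases hhit : (segment ℝ p₀ p₁ ∩ convexHull ℝ {q₀, q₁, q₂}).Nonempty
  · have hopp := tetVolume_mul_neg_of_hit h0 h1 hhit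
    obtain ⟨x, hx, hx'⟩ := id hhit
    obtain ⟨r, hr, rfl⟩ := mem_segment_iff_lineMap.1 hx
    -- Negation moves the branch cut to the positive real axis, which the curve avoids: it is real
    -- only at the hit, where it is negative.
    have key := integral_eq_arg_sub_arg (Z := fun s =>
      -angleNum (q₀ - AffineMap.lineMap (k := ℝ) p₀ p₁ s)
        (q₁ - AffineMap.lineMap (k := ℝ) p₀ p₁ s) (q₂ - AffineMap.lineMap (k := ℝ) p₀ p₁ s))
      cg (fun s => (hZ' s).neg) (fun s => by rw [neg_div_neg_eq]; exact hg s) ?_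
    · refine key.trans ?_
      have i0 : (angleNum (q₀ - AffineMap.lineMap (k := ℝ) p₀ p₁ (0 : ℝ))
        (q₁ - AffineMap.lineMap (k := ℝ) p₀ p₁ (0 : ℝ))
        (q₂ - AffineMap.lineMap (k := ℝ) p₀ p₁ (0 : ℝ))).im = tetVolume p₀ q₀ q₁ q₂ := by
        simp [angleNum, tetVolume]
      have i1 : (angleNum (q₀ - AffineMap.lineMap (k := ℝ) p₀ p₁ (1 : ℝ))
        (q₁ - AffineMap.lineMap (k := ℝ) p₀ p₁ (1 : ℝ))
        (q₂ - AffineMap.lineMap (k := ℝ) p₀ p₁ (1 : ℝ))).im = tetVolume p₁ q₀ q₁ q₂ := by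
        simp [angleNum, tetVolume]
      rw [hZ0, hZ1, signedHit, if_pos hhit]
      -- Undoing the negation shifts the arguments at the two ends by `π` in opposite directions,
      -- hence the difference by `2π` with the sign of the hit.
      rcases mul_neg_iff.1 hopp with ⟨s0, s1⟩ | ⟨s0, s1⟩
      · rw [if_pos s0, Complex.arg_neg_eq_arg_add_pi_of_im_neg (i1 ▸ s1),
          Complex.arg_neg_eq_arg_sub_pi_of_im_pos (i0 ▸ s0)]
        ring
      · rw [if_neg s0.not_gt, Complex.arg_neg_eq_arg_sub_pi_of_im_pos (i1 ▸ s1),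
          Complex.arg_neg_eq_arg_add_pi_of_im_neg (i0 ▸ s0)]
        ring
    · intro s hs
      rw [Complex.mem_slitPlane_iff]
      by_cases him : tetVolume (AffineMap.lineMap (k := ℝ) p₀ p₁ s) q₀ q₁ q₂ = 0
      · left
        -- The volume is affine in the parameter and takes opposite signs at the ends, so it has
        -- only one zero.
        have hrs : s = r := by
          have hr0 := tetVolume_eq_zero_of_mem_convexHull hx'
          rw [tetVolume_lineMap] at him hr0
          have e : (s - r) * (tetVolume p₁ q₀ q₁ q₂ - tetVolume p₀ q₀ q₁ q₂) = 0 := by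
            linear_combination him - hr0
          rcases mul_eq_zero.1 e with e | e
          · linarith
          · rw [sub_eq_zero.1 e] at hopp
            nlinarith
        subst hrs
        simpa [angleNum] using angleRe_neg_of_mem_convexHull (n01 s) (n12 s) (n20 s) hx'
      · right
        simpa [angleNum, tetVolume] using him
  · rw [signedHit, if_neg hhit, mul_zero, add_zero, hZ0, hZ1]
    refine integral_eq_arg_sub_arg cg hZ' hg fun s hs => ?_
    rw [Complex.mem_slitPlane_iff]
    by_cases him : tetVolume (AffineMap.lineMap (k := ℝ) p₀ p₁ s) q₀ q₁ q₂ = 0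
    · left
      refine angleRe_pos_of_notMem_convexHull (n01 s) (n12 s) (n20 s) (fun hmem => hhit ?_) him h0
      exact ⟨_, mem_segment_iff_lineMap.2 ⟨s, hs, rfl⟩, hmem⟩
    · right
      simpa [angleNum, tetVolume] using him

end Edge

/-! ### The linking number as a signed count of intersections. -/

/-- Two triangles in general position: none of the relevant tetrahedra degenerates. -/
structure GeneralPosition (p q : Fin 3 → E3) : Prop where
  edges : ∀ i j, tetVolume (p i) (q j) (q (j + 1)) (p (i + 1)) ≠ 0
  left : ∀ i, tetVolume (p i) (q 0) (q 1) (q 2) ≠ 0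
  right : ∀ i, tetVolume (q i) (p 0) (p 1) (p 2) ≠ 0

lemma tetVolume_edges_swap (x y z w : E3) : tetVolume z x y w = tetVolume x z w y := by
  simp only [tetVolume, tripleProduct_eq, PiLp.sub_apply]
  ring

namespace GeneralPosition
variable {p q : Fin 3 → E3}

protected lemma symm (h : GeneralPosition p q) : GeneralPosition q p where
  edges i j := by
    rw [tetVolume_edges_swap]
    exact h.edges j i
  left := h.right
  right := h.left

lemma lineMap_ne (h : GeneralPosition p q) (i j : Fin 3) (s t : ℝ) :
    AffineMap.lineMap (k := ℝ) (p i) (p (i + 1)) s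
      ≠ AffineMap.lineMap (k := ℝ) (q j) (q (j + 1)) t := by
  intro heq
  apply h.edges i j
  rw [← tripleProduct_sub_lineMap _ _ _ _ s, heq]
  simp only [tripleProduct_eq, PiLp.sub_apply, lineMap_apply_coords]
  ring

lemma disjoint_triangleCurve (h : GeneralPosition p q) :
    Disjoint (triangleCurve p) (triangleCurve q) := by
  rw [Set.disjoint_left]
  rintro x ⟨_, ⟨i, rfl⟩, hx⟩ ⟨_, ⟨j, rfl⟩, hx'⟩
  obtain ⟨s, -, rfl⟩ := mem_segment_iff_lineMap.1 hx
  obtain ⟨t, -, ht⟩ := mem_segment_iff_lineMap.1 hx'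
  exact h.lineMap_ne i j s t ht.symm

lemma continuous_gauss_integrand (h : GeneralPosition p q) (i j : Fin 3) :
    Continuous fun z : ℝ × ℝ => tripleProduct (p (i + 1) - p i) (q (j + 1) - q j)
      (edgeArc p i z.1 - edgeArc q j z.2) / ‖edgeArc p i z.1 - edgeArc q j z.2‖ ^ 3 := by
  have hc : Continuous fun z : ℝ × ℝ => edgeArc p i z.1 - edgeArc q j z.2 :=
    (AffineMap.lineMap_continuous.comp continuous_fst).sub
      (AffineMap.lineMap_continuous.comp continuous_snd)
  refine Continuous.div ?_ (hc.norm.pow 3) fun z => ?_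
  · simp only [tripleProduct_eq]
    fun_prop
  · exact pow_ne_zero _ (norm_ne_zero_iff.2 (sub_ne_zero.2 (h.lineMap_ne i j _ _)))

/-- Fubini applies since the integrand is continuous on the square. Exchanging the first two vectors
and reversing the third each change the sign of the triple product, so the signs cancel. -/
lemma gaussIntegral_comm (h : GeneralPosition p q) (i j : Fin 3) :
    gaussIntegral (edgeArc p i) (edgeArc q j) = gaussIntegral (edgeArc q j) (edgeArc p i) := by
  have dp (s : ℝ) : deriv (edgeArc p i) s = p (i + 1) - p i := (hasDerivAt_lineMap_E3 _ _ s).deriv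
  have dq (s : ℝ) : deriv (edgeArc q j) s = q (j + 1) - q j := (hasDerivAt_lineMap_E3 _ _ s).deriv
  simp only [gaussIntegral, dp, dq]
  rw [MeasureTheory.intervalIntegral_intervalIntegral_swap]
  · congr 1 with t
    congr 1 with s
    rw [norm_sub_rev]
    congr 1
    simp only [tripleProduct_eq, PiLp.sub_apply]
    ring
  · exact ((h.continuous_gauss_integrand i j).continuousOn.integrableOn_compact
      (isCompact_uIcc.prod isCompact_uIcc)).mono_set
      (Set.prod_mono Set.uIoc_subset_uIcc Set.uIoc_subset_uIcc)

lemma linkingNumber_comm (h : GeneralPosition p q) : linkingNumber p q = linkingNumber q p := by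
  rw [linkingNumber, linkingNumber, Finset.sum_comm]
  simp only [h.gaussIntegral_comm]

/-- The linking number counts the signed intersections of one triangle's edges with the other
triangle's convex hull. -/
lemma linkingNumber_eq (h : GeneralPosition p q) :
    linkingNumber p q = ∑ i, signedHit (p i) (p (i + 1)) (q 0) (q 1) (q 2) := by
  have key (i : Fin 3) : ∑ j, gaussIntegral (edgeArc p i) (edgeArc q j)
      = 2 * (halfAngle (p (i + 1)) (q 0) (q 1) (q 2) - halfAngle (p i) (q 0) (q 1) (q 2)
          + 2 * Real.pi * signedHit (p i) (p (i + 1)) (q 0) (q 1) (q 2)) := by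
    rw [Fin.sum_univ_three]
    exact sum_gaussIntegral_lineMap (h.edges i 0) (h.edges i 1) (h.edges i 2) (h.left i)
      (h.left (i + 1))
  have tele : ∑ i, (halfAngle (p (i + 1)) (q 0) (q 1) (q 2) - halfAngle (p i) (q 0) (q 1) (q 2))
      = 0 := by
    rw [Finset.sum_sub_distrib, sub_eq_zero]
    exact Equiv.sum_comp (Equiv.addRight (1 : Fin 3)) fun i => halfAngle (p i) (q 0) (q 1) (q 2)
  rw [linkingNumber]
  simp only [key]
  rw [← Finset.mul_sum, Finset.sum_add_distrib, tele, ← Finset.mul_sum]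
  have := Real.pi_ne_zero
  field_simp
  ring

lemma notMem_segment (h : GeneralPosition p q) (i : Fin 3) :
    p (i + 2) ∉ segment ℝ (p i) (p (i + 1)) := by
  intro hmem
  obtain ⟨s, -, hs⟩ := mem_segment_iff_lineMap.1 hmem
  have hz : tetVolume (q 0) (p i) (p (i + 1)) (p (i + 2)) = 0 := by
    rw [← hs]
    simp only [tetVolume, tripleProduct_eq, PiLp.sub_apply, lineMap_apply_coords]
    ring
  apply h.right 0
  rw [← hz]
  fin_cases i <;> simp [tetVolume, tripleProduct_eq] <;> ring

/-- Any other edge has the vertex opposite to the given edge as an endpoint. Injectivity lets edges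
be counted by index instead of as sets. -/
lemma injective_edges (h : GeneralPosition p q) :
    Function.Injective fun i : Fin 3 => segment ℝ (p i) (p (i + 1)) := by
  intro i j hij
  by_contra hne
  apply h.notMem_segment i
  have hj : i + 2 = j ∨ i + 2 = j + 1 := by
    fin_cases i <;> fin_cases j <;> simp_all
  dsimp only at hij
  rw [hij]
  rcases hj with hj | hj <;> rw [hj]
  · exact left_mem_segment _ _ _
  · exact right_mem_segment _ _ _

end GeneralPosition

/-! ### Counting crossings, and general position from non-coplanarity. -/

lemma existsUnique_mem_range_iff {α β : Type*} {f : α → β} (hf : Function.Injective f)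
    (P : β → Prop) : (∃! b, b ∈ Set.range f ∧ P b) ↔ ∃! a, P (f a) := by
  constructor
  · rintro ⟨_, ⟨⟨a, rfl⟩, ha⟩, hu⟩
    exact ⟨a, ha, fun a' ha' => hf (hu _ ⟨⟨a', rfl⟩, ha'⟩)⟩
  · rintro ⟨a, ha, hu⟩
    refine ⟨f a, ⟨⟨a, rfl⟩, ha⟩, ?_⟩
    rintro _ ⟨⟨a', rfl⟩, ha'⟩
    rw [hu a' ha']

lemma existsUnique_fin_three {P : Fin 3 → Prop} : (∃! i, P i) ↔
    (P 0 ∧ ¬ P 1 ∧ ¬ P 2) ∨ (¬ P 0 ∧ P 1 ∧ ¬ P 2) ∨ (¬ P 0 ∧ ¬ P 1 ∧ P 2) := by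
  simp only [ExistsUnique, Fin.exists_fin_succ, Fin.forall_fin_succ]
  simp
  tauto

/-- Three side changes around a cycle of length three are contradictory, and two have opposite
directions and cancel. -/
lemma signed_sum_three_ne_zero_iff {P₀ P₁ P₂ V₀ V₁ V₂ : Prop} [Decidable P₀] [Decidable P₁]
    [Decidable P₂] [Decidable V₀] [Decidable V₁] [Decidable V₂] (h0 : P₀ → (V₀ ↔ ¬ V₁))
    (h1 : P₁ → (V₁ ↔ ¬ V₂)) (h2 : P₂ → (V₂ ↔ ¬ V₀)) :
    ((if P₀ then (if V₀ then (1 : ℝ) else -1) else 0) + (if P₁ then (if V₁ then 1 else -1) else 0)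
      + (if P₂ then (if V₂ then 1 else -1) else 0)) ≠ 0 ↔
      (P₀ ∧ ¬ P₁ ∧ ¬ P₂) ∨ (¬ P₀ ∧ P₁ ∧ ¬ P₂) ∨ (¬ P₀ ∧ ¬ P₁ ∧ P₂) := by
  by_cases P₀ <;> by_cases P₁ <;> by_cases P₂ <;> by_cases V₀ <;> by_cases V₁ <;>
    by_cases V₂ <;> simp_all

open Classical in
/-- Crossings of a closed curve with three edges cancel unless there is exactly one. -/
lemma sum_signed_ne_zero_iff {P : Fin 3 → Prop} {V : Fin 3 → ℝ}
    (hP : ∀ i, P i → V i * V (i + 1) < 0) :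
    (∑ i, (if P i then (if 0 < V i then (1 : ℝ) else -1) else 0)) ≠ 0 ↔ ∃! i, P i := by
  rw [existsUnique_fin_three, Fin.sum_univ_three]
  have h0 : P 0 → (0 < V 0 ↔ ¬ 0 < V 1) := fun h => by
    rcases mul_neg_iff.1 (hP 0 h) with ⟨h1, h2⟩ | ⟨h1, h2⟩
    · exact iff_of_true h1 h2.not_gt
    · exact iff_of_false h1.not_gt (not_not.2 h2)
  have h1 : P 1 → (0 < V 1 ↔ ¬ 0 < V 2) := fun h => by
    rcases mul_neg_iff.1 (hP 1 h) with ⟨h1, h2⟩ | ⟨h1, h2⟩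
    · exact iff_of_true h1 h2.not_gt
    · exact iff_of_false h1.not_gt (not_not.2 h2)
  have h2 : P 2 → (0 < V 2 ↔ ¬ 0 < V 0) := fun h => by
    rcases mul_neg_iff.1 (hP 2 h) with ⟨h1, h2⟩ | ⟨h1, h2⟩
    · exact iff_of_true h1 h2.not_gt
    · exact iff_of_false h1.not_gt (not_not.2 h2)
  exact signed_sum_three_ne_zero_iff h0 h1 h2

lemma GeneralPosition.linked_iff {p q : Fin 3 → E3} (h : GeneralPosition p q) :
    Linked p q ↔ ∃! s : Set E3, s ∈ triangleEdges p ∧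
      (s ∩ convexHull ℝ {q 0, q 1, q 2}).Nonempty := by
  rw [Linked, and_iff_right h.disjoint_triangleCurve, h.linkingNumber_eq, triangleEdges,
    existsUnique_mem_range_iff h.injective_edges]
  exact sum_signed_ne_zero_iff fun i => tetVolume_mul_neg_of_hit (h.left i) (h.left (i + 1))

lemma GeneralPosition.linked_comm {p q : Fin 3 → E3} (h : GeneralPosition p q) :
    Linked p q ↔ Linked q p := by
  rw [Linked, Linked, disjoint_comm, h.linkingNumber_comm]

lemma coplanar_of_tetVolume_eq_zero {x p q r : E3} (h : tetVolume x p q r = 0) :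
    Coplanar ℝ ({x, p, q, r} : Set E3) := by
  rw [coplanar_iff_finrank_le_two, vectorSpan_eq_span_vsub_set_right ℝ (Set.mem_insert x _)]
  have himg : (· -ᵥ x) '' ({x, p, q, r} : Set E3)
      = insert 0 (Set.range ![p - x, q - x, r - x]) := by
    simp only [Set.image_insert_eq, Set.image_singleton, vsub_eq_sub, sub_self, Matrix.range_cons,
      Matrix.range_empty, Set.union_empty, Set.singleton_union]
  rw [himg, Submodule.span_insert_zero]
  have hle := finrank_range_le_card (R := ℝ) ![p - x, q - x, r - x]
  have hne : ¬ LinearIndependent ℝ ![p - x, q - x, r - x] := by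
    obtain ⟨l, m, n, hne, hw⟩ := exists_weights h
    intro hli
    have := Fintype.linearIndependent_iff.1 hli ![l, m, n]
      (by simpa [Fin.sum_univ_three] using hw)
    have h0 : l = 0 := this 0
    have h1 : m = 0 := this 1
    have h2 : n = 0 := this 2
    tauto
  rw [linearIndependent_iff_card_eq_finrank_span, Fintype.card_fin] at hne
  rw [Fintype.card_fin] at hle
  rw [Set.finrank] at hle hne
  omega

theorem mainTheorem2 (a b c d e f : E3)
    (hdistinct : [a, b, c, d, e, f].Nodup)
    (hcoplanar : ∀ s : Set E3, s ⊆ {a, b, c, d, e, f} → s.ncard = 4 → ¬ Coplanar ℝ s) :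
    List.TFAE [
      Linked ![a, b, c] ![d, e, f],
      ∃! s : Set E3, s ∈ triangleEdges ![a, b, c] ∧ (s ∩ convexHull ℝ {d, e, f}).Nonempty,
      ∃! s : Set E3, s ∈ triangleEdges ![d, e, f] ∧ (s ∩ convexHull ℝ {a, b, c}).Nonempty] := by
  have key (x p q r : E3) (hsub : ({x, p, q, r} : Set E3) ⊆ {a, b, c, d, e, f})
      (hnd : [x, p, q, r].Nodup) : tetVolume x p q r ≠ 0 := by
    intro h
    refine hcoplanar _ hsub ?_ (coplanar_of_tetVolume_eq_zero h)
    simp only [List.nodup_cons, List.mem_cons, List.not_mem_nil, not_or, or_false] at hnd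
    rw [Set.ncard_insert_of_notMem (by simp [hnd]), Set.ncard_insert_of_notMem (by simp [hnd]),
      Set.ncard_pair (by simp [hnd])]
  have hd := hdistinct
  simp only [List.nodup_cons, List.mem_cons, List.not_mem_nil, not_or, or_false] at hd
  have hg : GeneralPosition ![a, b, c] ![d, e, f] := by
    constructor
    · intro i j
      fin_cases i <;> fin_cases j <;> apply key <;>
        simp [Set.insert_subset_iff, hd, eq_comm]
    · intro i
      fin_cases i <;> apply key <;>
        simp [Set.insert_subset_iff, hd, eq_comm]
    · intro i
      fin_cases i <;> apply key <;>
        simp [Set.insert_subset_iff, hd, eq_comm]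
  tfae_have 1 ↔ 2 := hg.linked_iff
  tfae_have 1 ↔ 3 := hg.linked_comm.trans hg.symm.linked_iff
  tfae_finish
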